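/- Let $A$ be a commutative ring with unit, let $n \ge 0$, and let $a = (a_1,\dots,a_n)$ and $b = (b_1,\dots,b_n)$ be two sequences of elements of $A$, regarded also as row matrices. Write $J(a)$ and $J(b)$ for the ideals of $A$ generated by the entries of $a$ and of $b$. A sequence $c = (c_1,\dots,c_n)$ in $A$ is called completely sequent if its Koszul homology vanishes in positive degrees: $H_i(c, A) = 0$ for all $i \ge 1$, where $H_i(c,A)$ is the homology of the Koszul complex $K_\bullet(c,A)$ with $K_i = \bigwedge^i A^n$. For ideals $I, I'$ of $A$ write $I : I' = \{z \in A : z I' \subseteq I\}$. Suppose that $J(b) \subseteq J(a)$ and that $b$ is completely sequent, and let $\varphi \in A^{n\times n}$ be any matrix with $b = a\cdot\varphi$. Then the sequence $a$ is also completely sequent, and $$J(b) : J(a) = J(b) + \det(\varphi)A, \qquad J(b) : \bigl(J(b) + \det(\varphi)A\bigr) = J(a).$$ Moreover, if $J(a) \ne A$, then $\det(\varphi) \notin J(b)$. -/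

import Mathlib

noncomputable section

namespace Koszul

open CategoryTheory

universe u

variable {A : Type u} [CommRing A] {n : ℕ}

/-- The linear form `e_i ↦ a_i` on `A ^ n` attached to the sequence `a = (a_1, …, a_n)`, that is,
the row matrix `a` viewed as a map `A ^ n → A`, `v ↦ ∑ i, a i * v i`. -/
def form (a : Fin n → A) : Module.Dual A (Fin n → A) :=
  ∑ i, a i • LinearMap.proj i

/-- Contraction of an exterior algebra by a linear form lowers the degree by one. -/
theorem contractLeft_mem {M : Type u} [AddCommGroup M] [Module A M] (f : Module.Dual A M)
    (i : ℕ) : ∀ x ∈ ⋀[A]^(i + 1) M,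
      CliffordAlgebra.contractLeft (Q := (0 : QuadraticForm A M)) f x ∈ ⋀[A]^i M := by
  induction i with
  | zero =>
    intro x hx
    rw [zero_add, ExteriorAlgebra.exteriorPower, pow_one] at hx
    obtain ⟨v, rfl⟩ := hx
    rw [ExteriorAlgebra.exteriorPower, pow_zero]
    exact Submodule.mem_one.2 ⟨f v, (CliffordAlgebra.contractLeft_ι _ f v).symm⟩
  | succ i ih =>
    intro x hx
    rw [ExteriorAlgebra.exteriorPower, pow_succ'] at hx
    induction hx using Submodule.mul_induction_on' with
    | mem_mul_mem y hy z hz =>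
      obtain ⟨v, rfl⟩ := hy
      have h := CliffordAlgebra.contractLeft_ι_mul (Q := (0 : QuadraticForm A M)) f v z
      refine h ▸ Submodule.sub_mem _ (Submodule.smul_mem _ _ hz) ?_
      rw [ExteriorAlgebra.exteriorPower, pow_succ']
      exact Submodule.mul_mem_mul ⟨v, rfl⟩ (ih z hz)
    | add y _ z _ hy hz =>
      rw [map_add]
      exact Submodule.add_mem _ hy hz

/-- The Koszul differential `⋀^(i+1) (A ^ n) → ⋀^i (A ^ n)` of the sequence `a`: contraction by the
linear form `e_j ↦ a_j`, i.e. `v_0 ∧ ⋯ ∧ v_i ↦ ∑ k, (-1)^k a(v_k) • v_0 ∧ ⋯ v̂_k ⋯ ∧ v_i`. -/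
def d (a : Fin n → A) (i : ℕ) : ⋀[A]^(i + 1) (Fin n → A) →ₗ[A] ⋀[A]^i (Fin n → A) :=
  (CliffordAlgebra.contractLeft (Q := (0 : QuadraticForm A (Fin n → A))) (form a)).restrict
    (contractLeft_mem (form a) i)

theorem d_comp_d (a : Fin n → A) (i : ℕ) : d a i ∘ₗ d a (i + 1) = 0 :=
  LinearMap.ext fun x => Subtype.ext
    (CliffordAlgebra.contractLeft_contractLeft (Q := (0 : QuadraticForm A (Fin n → A)))
      (form a) x.1)

/-- The Koszul complex `K.(a, A)`: it is `⋀^i (A ^ n)` in degree `i`. -/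
def complex (a : Fin n → A) : ChainComplex (ModuleCat.{u} A) ℕ :=
  ChainComplex.of (fun i => ModuleCat.of A (⋀[A]^i (Fin n → A)))
    (fun i => ModuleCat.ofHom (d a i))
    (fun i => by rw [← ModuleCat.ofHom_comp, d_comp_d]; rfl)

/-- The Koszul homology module `H_i(a, A)`. -/
def homology (a : Fin n → A) (i : ℕ) : ModuleCat.{u} A :=
  (complex a).homology i

/-- The sequence `a` is completely sequent: `H_i(a, A) = 0` for all `i ≥ 1`. -/
def CompletelySequent (a : Fin n → A) : Prop :=
  ∀ i : ℕ, 1 ≤ i → Subsingleton (homology a i)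

/-- The ideal `J(a)` generated by the entries of the sequence `a`. -/
def J (a : Fin n → A) : Ideal A :=
  Ideal.span (Set.range a)

end Koszul

end

/-!
Write `Λ` for the exterior algebra of `V = A ^ n`, with the Koszul differentials `d_a` and `d_b`,
and consider the double Koszul complex `Λ ⊗ Λ` with differential `D = d_b ⊗ 1 - sgn ⊗ d_a`. It is
computed in two ways.

Since `b` is completely sequent and `Λ` is flat, `d_b` resolves `A / J(b)`, so the augmentation of
the first factor is a quasi-isomorphism from `(Λ ⊗ Λ, D)` to the Koszul complex of `a` with
coefficients in `A / J(b)`. This is `exists_diff_eq` (injectivity on homology) and `exists_cycle`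
(surjectivity), proved by induction on the degree in the second factor.

On the other hand `b = a φ` says that the linear form `(v, w) ↦ b(v) - a(w)` on `V × V` depends
only on `w - φ v`. The algebra automorphism of `Λ(V × V) = Λ ⊗ Λ` given by `(v, w) ↦ (v, w + φ v)`,
here called `shear φ`, therefore transforms the differential `-sgn ⊗ d_a` into `D`
(`diff_shear`), and the homology of `D` is `Λ ⊗ H(a)`. Followed by the augmentation, the shear is
`u ⊗ x ↦ Λφ(u) x` (`evAug_shear`).

Let `e = e_1 ∧ ⋯ ∧ e_n`, so that `Λφ(e) = det φ • e`. The cycle `e ⊗ x`, for a cycle `x` of `d_a`,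
corresponds to `det φ • e x` modulo `J(b)`. When `x` has positive degree this vanishes, so
`e ⊗ x` is a boundary and so is `x`: the sequence `a` is completely sequent. When `x = c` is a
scalar, this shows that `c det φ ∈ J(b)` implies `c ∈ J(a)` (`mem_range_of_det_mul_mem`).
Finally, if `c J(a) ⊆ J(b)`, then `c • e` is a cycle modulo `J(b)`, so it comes from a cycle of
`Λ ⊗ Λ`, hence from some `u ⊗ 1`, and its top coefficient `c` is a multiple of `det φ` modulo
`J(b)` (`exists_sub_det_mul_mem`). Together with Cramer's rule (`mul_det_mem`) these give the
two colon ideals and the nontriviality of `det φ`.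

All differentials are treated on the whole exterior algebra instead of degree by degree;
`completelySequent_iff_acyclic` translates.
-/

noncomputable section

namespace Koszul

open scoped TensorProduct

/-! ### Contraction and grading on the exterior algebra -/

section Exterior

variable {A : Type*} [CommRing A] {M : Type*} [AddCommGroup M] [Module A M]

/-- Contraction by a linear form `f`, as an endomorphism of the exterior algebra: the unique
antiderivation extending `f`. For `f = form a` it is the Koszul differential in all degrees at
once. -/
def contr (f : Module.Dual A M) : ExteriorAlgebra A M →ₗ[A] ExteriorAlgebra A M :=
  CliffordAlgebra.contractLeft (Q := (0 : QuadraticForm A M)) f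

/-- The grading involution `x ↦ (-1)^i x` for `x` of degree `i`. -/
def sgn : ExteriorAlgebra A M →ₗ[A] ExteriorAlgebra A M :=
  (CliffordAlgebra.involute (Q := (0 : QuadraticForm A M))).toLinearMap

/-- Left multiplication by a vector on the exterior algebra. -/
def wedge (v : M) : ExteriorAlgebra A M →ₗ[A] ExteriorAlgebra A M :=
  LinearMap.mulLeft A (ExteriorAlgebra.ι A v)

/-- The augmentation of the exterior algebra, that is, the projection to degree zero. -/
def aug : ExteriorAlgebra A M →ₐ[A] A :=
  ExteriorAlgebra.algebraMapInv

theorem wedge_apply (v : M) (x : ExteriorAlgebra A M) :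
    wedge v x = ExteriorAlgebra.ι A v * x := rfl

theorem wedge_wedge (v : M) (x : ExteriorAlgebra A M) : wedge v (wedge v x) = 0 := by
  rw [wedge_apply, wedge_apply, ← mul_assoc, ExteriorAlgebra.ι_sq_zero, zero_mul]

theorem wedge_add (v w : M) : (wedge (v + w) : ExteriorAlgebra A M →ₗ[A] _) =
    wedge v + wedge w :=
  LinearMap.ext fun x => by simp [wedge_apply, add_mul]

theorem wedge_smul (c : A) (v : M) : (wedge (c • v) : ExteriorAlgebra A M →ₗ[A] _) =
    c • wedge v :=
  LinearMap.ext fun x => by simp [wedge_apply]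

theorem contr_one (f : Module.Dual A M) : contr f 1 = 0 :=
  CliffordAlgebra.contractLeft_one _ f

theorem contr_algebraMap (f : Module.Dual A M) (c : A) :
    contr f (algebraMap A (ExteriorAlgebra A M) c) = 0 :=
  CliffordAlgebra.contractLeft_algebraMap _ f c

theorem contr_wedge (f : Module.Dual A M) (v : M) (x : ExteriorAlgebra A M) :
    contr f (wedge v x) = f v • x - wedge v (contr f x) :=
  CliffordAlgebra.contractLeft_ι_mul _ _ _

theorem contr_contr (f : Module.Dual A M) (x : ExteriorAlgebra A M) : contr f (contr f x) = 0 :=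
  CliffordAlgebra.contractLeft_contractLeft _ _

theorem sgn_one : sgn (1 : ExteriorAlgebra A M) = 1 :=
  map_one (CliffordAlgebra.involute (Q := (0 : QuadraticForm A M)))

theorem sgn_wedge (v : M) (x : ExteriorAlgebra A M) : sgn (wedge v x) = -wedge v (sgn x) := by
  refine (map_mul (CliffordAlgebra.involute (Q := (0 : QuadraticForm A M))) _ _).trans ?_
  refine (congrArg (· * _) (CliffordAlgebra.involute_ι v)).trans ?_
  exact neg_mul _ _

theorem sgn_sgn (x : ExteriorAlgebra A M) : sgn (sgn x) = x :=
  CliffordAlgebra.involute_involute x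

theorem aug_one : aug (1 : ExteriorAlgebra A M) = 1 := map_one _

theorem aug_algebraMap (c : A) : aug (algebraMap A (ExteriorAlgebra A M) c) = c :=
  ExteriorAlgebra.algebraMap_leftInverse M c

theorem aug_ι (v : M) : aug (ExteriorAlgebra.ι A v) = 0 := by
  simp [aug, ExteriorAlgebra.algebraMapInv]

theorem aug_wedge (v : M) (x : ExteriorAlgebra A M) : aug (wedge v x) = 0 := by
  rw [wedge_apply, map_mul, aug_ι, zero_mul]

theorem wedge_induction {P : ExteriorAlgebra A M → Prop} (one : P 1)
    (smul : ∀ (c : A) x, P x → P (c • x)) (add : ∀ x y, P x → P y → P (x + y))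
    (wedge : ∀ v x, P x → P (wedge v x)) (x : ExteriorAlgebra A M) : P x := by
  induction x using CliffordAlgebra.left_induction with
  | algebraMap r =>
    have := smul r 1 one
    rwa [← Algebra.algebraMap_eq_smul_one] at this
  | add x y hx hy => exact add x y hx hy
  | ι_mul x v hx => exact wedge v x hx

theorem contr_sgn (f : Module.Dual A M) (x : ExteriorAlgebra A M) :
    contr f (sgn x) = -sgn (contr f x) := by
  induction x using wedge_induction with
  | one => simp [sgn_one, contr_one]
  | smul c x h => simp [h]
  | add x y hx hy => simp [hx, hy, add_comm]
  | wedge v x h => simp [sgn_wedge, contr_wedge, h]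

theorem aug_sgn (x : ExteriorAlgebra A M) : aug (sgn x) = aug x := by
  induction x using wedge_induction with
  | one => simp [sgn_one]
  | smul c x h => simp [h]
  | add x y hx hy => simp [hx, hy]
  | wedge v x h => simp [sgn_wedge, aug_wedge]

/-- The values of a contraction lie in the ideal generated by the values of the linear form. -/
theorem contr_mem_smul_top (f : Module.Dual A M) (I : Ideal A) (h : ∀ v, f v ∈ I)
    (x : ExteriorAlgebra A M) : contr f x ∈ (I • ⊤ : Submodule A (ExteriorAlgebra A M)) := by
  induction x using wedge_induction with
  | one => simp [contr_one]
  | smul c x h => rw [map_smul]; exact Submodule.smul_mem _ _ h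
  | add x y hx hy => rw [map_add]; exact Submodule.add_mem _ hx hy
  | wedge v x hx =>
    rw [contr_wedge]
    refine Submodule.sub_mem _ (Submodule.smul_mem_smul (h v) trivial) ?_
    have := Submodule.mem_map_of_mem (f := (wedge v : ExteriorAlgebra A M →ₗ[A] _)) hx
    rw [Submodule.map_smul''] at this
    exact Submodule.smul_mono le_rfl le_top this

/-- The component of degree `i` of an element of the exterior algebra. -/
def component (i : ℕ) : ExteriorAlgebra A M →ₗ[A] ExteriorAlgebra A M :=
  GradedAlgebra.proj (fun i : ℕ => ⋀[A]^i M) i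

theorem component_mem (i : ℕ) (x : ExteriorAlgebra A M) : component i x ∈ ⋀[A]^i M :=
  (DirectSum.decompose (fun i : ℕ => ⋀[A]^i M) x i).2

theorem component_of_mem {i : ℕ} {x : ExteriorAlgebra A M} (hx : x ∈ ⋀[A]^i M) (j : ℕ) :
    component j x = if i = j then x else 0 := by
  split_ifs with h
  · subst h
    exact DirectSum.decompose_of_mem_same (fun i : ℕ => ⋀[A]^i M) hx
  · exact DirectSum.decompose_of_mem_ne (fun i : ℕ => ⋀[A]^i M) hx h

/-- A version of `contractLeft_mem` without constraints on universes. -/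
theorem contr_mem (f : Module.Dual A M) {i : ℕ} {x : ExteriorAlgebra A M}
    (hx : x ∈ ⋀[A]^(i + 1) M) : contr f x ∈ ⋀[A]^i M := by
  induction i generalizing x with
  | zero =>
    rw [zero_add, ExteriorAlgebra.exteriorPower, pow_one] at hx
    obtain ⟨v, rfl⟩ := hx
    rw [ExteriorAlgebra.exteriorPower, pow_zero]
    exact Submodule.mem_one.2 ⟨f v, (CliffordAlgebra.contractLeft_ι _ f v).symm⟩
  | succ i ih =>
    rw [ExteriorAlgebra.exteriorPower, pow_succ'] at hx
    induction hx using Submodule.mul_induction_on' with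
    | mem_mul_mem y hy z hz =>
      obtain ⟨v, rfl⟩ := hy
      rw [← wedge_apply, contr_wedge]
      refine Submodule.sub_mem _ (Submodule.smul_mem _ _ hz) ?_
      rw [ExteriorAlgebra.exteriorPower, pow_succ']
      exact Submodule.mul_mem_mul ⟨v, rfl⟩ (ih hz)
    | add y _ z _ hy hz =>
      rw [map_add]
      exact Submodule.add_mem _ hy hz

theorem component_contr (f : Module.Dual A M) (j : ℕ) (x : ExteriorAlgebra A M) :
    component j (contr f x) = contr f (component (j + 1) x) := by
  induction x using DirectSum.Decomposition.inductionOn (fun i : ℕ => ⋀[A]^i M) with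
  | zero => simp
  | add x y hx hy => simp [hx, hy]
  | @homogeneous i x =>
    obtain ⟨x, hx⟩ := x
    simp only
    cases i with
    | zero =>
      rw [component_of_mem hx, if_neg (by omega)]
      rw [ExteriorAlgebra.exteriorPower, pow_zero] at hx
      obtain ⟨c, rfl⟩ := Submodule.mem_one.1 hx
      simp [contr_algebraMap]
    | succ i =>
      rw [component_of_mem hx, component_of_mem (contr_mem f hx)]
      by_cases h : i = j <;> simp [h]

theorem aug_of_mem {i : ℕ} {x : ExteriorAlgebra A M} (hx : x ∈ ⋀[A]^(i + 1) M) : aug x = 0 := by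
  rw [ExteriorAlgebra.exteriorPower, pow_succ'] at hx
  induction hx using Submodule.mul_induction_on' with
  | mem_mul_mem y hy z hz =>
    obtain ⟨v, rfl⟩ := hy
    exact aug_wedge v z
  | add y _ z _ hy hz => rw [map_add, hy, hz, add_zero]

theorem component_zero (x : ExteriorAlgebra A M) : component 0 x = algebraMap A _ (aug x) := by
  induction x using DirectSum.Decomposition.inductionOn (fun i : ℕ => ⋀[A]^i M) with
  | zero => simp
  | add x y hx hy => simp [hx, hy]
  | @homogeneous i x =>
    obtain ⟨x, hx⟩ := x
    simp only
    cases i with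
    | zero =>
      rw [component_of_mem hx, if_pos rfl]
      rw [ExteriorAlgebra.exteriorPower, pow_zero] at hx
      obtain ⟨c, rfl⟩ := Submodule.mem_one.1 hx
      rw [aug_algebraMap]
    | succ i => rw [component_of_mem hx, if_neg (by omega), aug_of_mem hx, map_zero]

/-- The truncation of an element of the exterior algebra to degrees `< k`. -/
def trunc (k : ℕ) : ExteriorAlgebra A M →ₗ[A] ExteriorAlgebra A M :=
  ∑ i ∈ Finset.range k, component i

theorem trunc_of_mem {i : ℕ} {x : ExteriorAlgebra A M} (hx : x ∈ ⋀[A]^i M) (k : ℕ) :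
    trunc k x = if i < k then x else 0 := by
  simp [trunc, LinearMap.sum_apply, component_of_mem hx]

theorem trunc_zero : (trunc 0 : ExteriorAlgebra A M →ₗ[A] _) = 0 := by simp [trunc]

theorem trunc_comp_trunc {j k : ℕ} (h : j ≤ k) :
    (trunc k ∘ₗ trunc j : ExteriorAlgebra A M →ₗ[A] _) = trunc j := by
  refine LinearMap.ext fun x => ?_
  induction x using DirectSum.Decomposition.inductionOn (fun i : ℕ => ⋀[A]^i M) with
  | zero => simp
  | add x y hx hy => rw [map_add, map_add, hx, hy]
  | @homogeneous i x =>
    obtain ⟨x, hx⟩ := x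
    simp only [LinearMap.comp_apply, trunc_of_mem hx]
    split_ifs with h1
    · rw [trunc_of_mem hx, if_pos (by omega)]
    · simp

theorem contr_comp_trunc (f : Module.Dual A M) (k : ℕ) :
    contr f ∘ₗ trunc (k + 1) = trunc k ∘ₗ contr f := by
  refine LinearMap.ext fun x => ?_
  have h0 : contr f (component 0 x) = 0 := by rw [component_zero, contr_algebraMap]
  simp [trunc, LinearMap.sum_apply, component_contr, Finset.sum_range_succ', h0]

theorem exists_trunc_eq (x : ExteriorAlgebra A M) :
    ∃ k, ∀ m, k ≤ m → trunc m x = x := by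
  induction x using DirectSum.Decomposition.inductionOn (fun i : ℕ => ⋀[A]^i M) with
  | zero => exact ⟨0, by simp⟩
  | add x y hx hy =>
    obtain ⟨k, hk⟩ := hx
    obtain ⟨l, hl⟩ := hy
    exact ⟨max k l, fun m hm => by
      rw [map_add, hk m (le_trans (le_max_left _ _) hm), hl m (le_trans (le_max_right _ _) hm)]⟩
  | @homogeneous i x =>
    exact ⟨i + 1, fun m hm => by rw [trunc_of_mem x.2, if_pos (by omega)]⟩

end Exterior

/-! ### The top exterior power of `A ^ n` -/

section Top

variable {A : Type*} [CommRing A] {n : ℕ}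

/-- The generator `e_1 ∧ ⋯ ∧ e_n` of the top exterior power of `A ^ n`. -/
def top : ExteriorAlgebra A (Fin n → A) :=
  ExteriorAlgebra.ιMulti A n (Pi.basisFun A (Fin n))

/-- The coefficient of `e_1 ∧ ⋯ ∧ e_n`, that is, the linear form sending `v_1 ∧ ⋯ ∧ v_n` to the
determinant of `(v_1, …, v_n)` and vanishing in all degrees other than `n`. -/
def topCoeff : ExteriorAlgebra A (Fin n → A) →ₗ[A] A :=
  ExteriorAlgebra.liftAlternating fun i =>
    if h : i = n then (Matrix.detRowAlternating (R := A) (n := Fin n)).domDomCongr (finCongr h.symm)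
    else 0

theorem topCoeff_ιMulti (v : Fin n → Fin n → A) :
    topCoeff (ExteriorAlgebra.ιMulti A n v) = Matrix.det (Matrix.of v) := by
  rw [topCoeff, ExteriorAlgebra.liftAlternating_apply_ιMulti, dif_pos rfl]
  rfl

theorem topCoeff_ιMulti_of_ne {i : ℕ} (h : i ≠ n) (v : Fin i → Fin n → A) :
    topCoeff (ExteriorAlgebra.ιMulti A i v) = 0 := by
  rw [topCoeff, ExteriorAlgebra.liftAlternating_apply_ιMulti, dif_neg h]
  rfl

theorem topCoeff_top : topCoeff (top : ExteriorAlgebra A (Fin n → A)) = 1 := by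
  rw [top, topCoeff_ιMulti]
  convert Matrix.det_one (n := Fin n) (R := A)
  ext i j
  simp [Matrix.one_apply, Pi.single_apply, eq_comm]

theorem ιMulti_succ_eq_zero :
    (ExteriorAlgebra.ιMulti A (n + 1) : (Fin n → A) [⋀^Fin (n + 1)]→ₗ[A] _) = 0 := by
  refine Module.Basis.ext_alternating (Pi.basisFun A (Fin n)) fun v hv => ?_
  have := Fintype.card_le_of_injective v hv
  simp at this

theorem topCoeff_of_mem {i : ℕ} (h : i ≠ n) {x : ExteriorAlgebra A (Fin n → A)}
    (hx : x ∈ ⋀[A]^i (Fin n → A)) : topCoeff x = 0 := by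
  rw [← ExteriorAlgebra.ιMulti_span_fixedDegree] at hx
  induction hx using Submodule.span_induction with
  | mem x hx => obtain ⟨v, rfl⟩ := hx; exact topCoeff_ιMulti_of_ne h v
  | zero => simp
  | add x y _ _ hx hy => rw [map_add, hx, hy, add_zero]
  | smul c x _ hx => rw [map_smul, hx, smul_zero]

theorem topCoeff_contr (f : Module.Dual A (Fin n → A)) (x : ExteriorAlgebra A (Fin n → A)) :
    topCoeff (contr f x) = 0 := by
  suffices h : topCoeff ∘ₗ contr f = 0 from LinearMap.congr_fun h x
  refine ExteriorAlgebra.lhom_ext fun i => AlternatingMap.ext fun v => ?_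
  change topCoeff (contr f (ExteriorAlgebra.ιMulti A i v)) = 0
  cases i with
  | zero => rw [ExteriorAlgebra.ιMulti_zero_apply, contr_one, map_zero]
  | succ i =>
    rcases eq_or_ne i n with rfl | h
    · rw [ιMulti_succ_eq_zero, AlternatingMap.zero_apply, map_zero, map_zero]
    · exact topCoeff_of_mem h (contr_mem f (ExteriorAlgebra.ιMulti_range A _ ⟨v, rfl⟩))

theorem top_mul_ι (v : Fin n → A) : top * ExteriorAlgebra.ι A v = 0 := by
  have h : ExteriorAlgebra.ι A v = ExteriorAlgebra.ιMulti A 1 ![v] := by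
    simp
  rw [top, h, ExteriorAlgebra.ιMulti_mul_ιMulti, ιMulti_succ_eq_zero, AlternatingMap.zero_apply]

theorem top_mul (x : ExteriorAlgebra A (Fin n → A)) : top * x = aug x • top := by
  induction x using ExteriorAlgebra.induction with
  | algebraMap c => rw [aug_algebraMap, ← Algebra.commutes, Algebra.smul_def]
  | ι v => rw [top_mul_ι, aug_ι, zero_smul]
  | mul x y hx hy => rw [← mul_assoc, hx, smul_mul_assoc, hy, map_mul, mul_smul]
  | add x y hx hy => rw [mul_add, hx, hy, map_add, add_smul]

theorem topCoeff_map (φ : Matrix (Fin n) (Fin n) A) (x : ExteriorAlgebra A (Fin n → A)) :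
    topCoeff (ExteriorAlgebra.map φ.mulVecLin x) = φ.det * topCoeff x := by
  suffices h : topCoeff ∘ₗ (ExteriorAlgebra.map φ.mulVecLin).toLinearMap = φ.det • topCoeff from
    LinearMap.congr_fun h x
  refine ExteriorAlgebra.lhom_ext fun i => AlternatingMap.ext fun v => ?_
  change topCoeff (ExteriorAlgebra.map _ (ExteriorAlgebra.ιMulti A i v)) =
    φ.det * topCoeff (ExteriorAlgebra.ιMulti A i v)
  rw [ExteriorAlgebra.map_apply_ιMulti]
  rcases eq_or_ne i n with rfl | h
  · rw [topCoeff_ιMulti, topCoeff_ιMulti, ← Matrix.det_transpose φ, mul_comm, ← Matrix.det_mul]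
    congr 1
    ext i j
    simp [Matrix.mul_apply, Matrix.mulVec, dotProduct, mul_comm]
  · rw [topCoeff_ιMulti_of_ne h, topCoeff_ιMulti_of_ne h, mul_zero]

theorem map_top (φ : Matrix (Fin n) (Fin n) A) :
    ExteriorAlgebra.map φ.mulVecLin top = φ.det • top := by
  -- The universal alternating map in `n` variables on `A ^ n` is the determinant times its value
  -- at the standard basis.
  have h : (ExteriorAlgebra.ιMulti A n : (Fin n → A) [⋀^Fin n]→ₗ[A] _) =
      (LinearMap.toSpanSingleton A _ top).compAlternatingMap
        (Matrix.detRowAlternating (R := A) (n := Fin n)) := by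
    refine Module.Basis.ext_alternating (Pi.basisFun A (Fin n)) fun s hs => ?_
    let π : Equiv.Perm (Fin n) := Equiv.ofBijective s (Finite.injective_iff_bijective.1 hs)
    change ExteriorAlgebra.ιMulti A n (Pi.basisFun A (Fin n) ∘ π) =
      LinearMap.toSpanSingleton A _ top
        (Matrix.detRowAlternating (R := A) (Pi.basisFun A (Fin n) ∘ π))
    rw [AlternatingMap.map_perm, AlternatingMap.map_perm]
    have h1 : Matrix.detRowAlternating (R := A) (Pi.basisFun A (Fin n)) = 1 := by
      rw [← topCoeff_top (A := A) (n := n), top, topCoeff_ιMulti]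
      rfl
    rw [h1, map_zsmul_unit, LinearMap.toSpanSingleton_apply, one_smul, top]
  have h2 : ExteriorAlgebra.map φ.mulVecLin top = ExteriorAlgebra.ιMulti A n
      (φ.mulVecLin ∘ Pi.basisFun A (Fin n)) := by
    rw [top, ExteriorAlgebra.map_apply_ιMulti]
  rw [h2, h]
  change Matrix.det (Matrix.of (φ.mulVecLin ∘ Pi.basisFun A (Fin n))) •
    (top : ExteriorAlgebra A (Fin n → A)) = _
  refine congrArg (fun c : A => c • (top : ExteriorAlgebra A (Fin n → A))) ?_
  rw [← Matrix.det_transpose]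
  congr 1
  ext i j
  simp

end Top

/-! ### The double Koszul complex -/

section Double

variable {A : Type*} [CommRing A] {M N : Type*} [AddCommGroup M] [Module A M]
  [AddCommGroup N] [Module A N]

/-- The tensor product of two exterior algebras, the underlying module of the double Koszul
complex. -/
abbrev Double (A M N : Type*) [CommRing A] [AddCommGroup M] [Module A M] [AddCommGroup N]
    [Module A N] : Type _ :=
  ExteriorAlgebra A M ⊗[A] ExteriorAlgebra A N

/-- The evaluation of a linear form `t` on the first tensor factor. -/
def ev (t : ExteriorAlgebra A M →ₗ[A] A) : Double A M N →ₗ[A] ExteriorAlgebra A N :=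
  (TensorProduct.lid A _).toLinearMap ∘ₗ t.rTensor (ExteriorAlgebra A N)

/-- The augmentation of the first tensor factor. -/
def evAug : Double A M N →ₗ[A] ExteriorAlgebra A N :=
  ev aug.toLinearMap

/-- The Koszul differential on the first factor. -/
def diffLeft (f : Module.Dual A M) : Double A M N →ₗ[A] Double A M N :=
  (contr f).rTensor _

/-- The Koszul differential on the second factor, twisted by the sign of the first factor. -/
def diffRight (g : Module.Dual A N) : Double A M N →ₗ[A] Double A M N :=
  TensorProduct.map sgn (contr g)

/-- The differential of the double Koszul complex. The minus sign is a choice, under which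
`shear φ` straightens the differential whenever `f = g ∘ φ`, see `diff_shear`. -/
def diff (f : Module.Dual A M) (g : Module.Dual A N) : Double A M N →ₗ[A] Double A M N :=
  diffLeft f - diffRight g

/-- Multiplication by a vector of the first factor. -/
def mulLeft (v : M) : Double A M N →ₗ[A] Double A M N :=
  (wedge v).rTensor _

/-- Multiplication by a vector of the second factor, with the sign of the graded tensor
product. -/
def mulRight (w : N) : Double A M N →ₗ[A] Double A M N :=
  TensorProduct.map sgn (wedge w)

section Tmul

variable (u : ExteriorAlgebra A M) (x : ExteriorAlgebra A N)

@[simp]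
theorem ev_tmul (t : ExteriorAlgebra A M →ₗ[A] A) : ev t (u ⊗ₜ x : Double A M N) = t u • x := rfl

@[simp]
theorem evAug_tmul : evAug (u ⊗ₜ x : Double A M N) = aug u • x := rfl

@[simp]
theorem diffLeft_tmul (f : Module.Dual A M) :
    diffLeft f (u ⊗ₜ x : Double A M N) = contr f u ⊗ₜ x := rfl

@[simp]
theorem diffRight_tmul (g : Module.Dual A N) :
    diffRight g (u ⊗ₜ x : Double A M N) = sgn u ⊗ₜ contr g x := rfl

@[simp]
theorem mulLeft_tmul (v : M) : mulLeft v (u ⊗ₜ x : Double A M N) = wedge v u ⊗ₜ x := rfl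

@[simp]
theorem mulRight_tmul (w : N) : mulRight w (u ⊗ₜ x : Double A M N) = sgn u ⊗ₜ wedge w x := rfl

end Tmul

theorem diff_apply (f : Module.Dual A M) (g : Module.Dual A N) (z : Double A M N) :
    diff f g z = diffLeft f z - diffRight g z := rfl

/-- Two linear maps on the double complex agree if they agree on pure tensors. -/
theorem congr_tmul {P : Type*} [AddCommGroup P] [Module A P] (S T : Double A M N →ₗ[A] P)
    (h : ∀ u x, S (u ⊗ₜ x) = T (u ⊗ₜ x)) (z : Double A M N) : S z = T z :=
  LinearMap.congr_fun (TensorProduct.ext' h) z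

theorem double_induction {P : Double A M N → Prop} (one : ∀ x, P (1 ⊗ₜ x))
    (smul : ∀ (c : A) z, P z → P (c • z)) (add : ∀ y z, P y → P z → P (y + z))
    (mul : ∀ v z, P z → P (mulLeft v z)) (z : Double A M N) : P z := by
  induction z using TensorProduct.induction_on with
  | zero => simpa using smul 0 _ (one 0)
  | add y z hy hz => exact add y z hy hz
  | tmul u x =>
    induction u using wedge_induction with
    | one => exact one x
    | smul c u h => exact smul c _ h
    | add u u' h h' => rw [TensorProduct.add_tmul]; exact add _ _ h h'
    | wedge v u h => exact mul v _ h

theorem diffLeft_diffLeft (f : Module.Dual A M) (z : Double A M N) :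
    diffLeft f (diffLeft f z) = 0 :=
  congr_tmul (diffLeft f ∘ₗ diffLeft f) 0 (fun u x => by simp [contr_contr]) z

theorem diffRight_diffRight (g : Module.Dual A N) (z : Double A M N) :
    diffRight g (diffRight g z) = 0 :=
  congr_tmul (diffRight g ∘ₗ diffRight g) 0 (fun u x => by simp [contr_contr]) z

theorem diffLeft_diffRight (f : Module.Dual A M) (g : Module.Dual A N) (z : Double A M N) :
    diffLeft f (diffRight g z) = -diffRight g (diffLeft f z) :=
  congr_tmul (diffLeft f ∘ₗ diffRight g) (-(diffRight g ∘ₗ diffLeft f))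
    (fun u x => by simp [contr_sgn, TensorProduct.neg_tmul]) z

theorem diff_diff (f : Module.Dual A M) (g : Module.Dual A N) (z : Double A M N) :
    diff f g (diff f g z) = 0 := by
  simp [diff_apply, diffLeft_diffLeft, diffRight_diffRight, diffLeft_diffRight]

theorem diffLeft_mulLeft (f : Module.Dual A M) (v : M) (z : Double A M N) :
    diffLeft f (mulLeft v z) = f v • z - mulLeft v (diffLeft f z) :=
  congr_tmul (diffLeft f ∘ₗ mulLeft v) (f v • LinearMap.id - mulLeft v ∘ₗ diffLeft f)
    (fun u x => by simp [contr_wedge, TensorProduct.sub_tmul, TensorProduct.smul_tmul']) z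

theorem diffRight_mulLeft (g : Module.Dual A N) (v : M) (z : Double A M N) :
    diffRight g (mulLeft v z) = -mulLeft v (diffRight g z) :=
  congr_tmul (diffRight g ∘ₗ mulLeft v) (-(mulLeft v ∘ₗ diffRight g))
    (fun u x => by simp [sgn_wedge, TensorProduct.neg_tmul]) z

theorem diffLeft_mulRight (f : Module.Dual A M) (w : N) (z : Double A M N) :
    diffLeft f (mulRight w z) = -mulRight w (diffLeft f z) :=
  congr_tmul (diffLeft f ∘ₗ mulRight w) (-(mulRight w ∘ₗ diffLeft f))
    (fun u x => by simp [contr_sgn, TensorProduct.neg_tmul]) z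

theorem diffRight_mulRight (g : Module.Dual A N) (w : N) (z : Double A M N) :
    diffRight g (mulRight w z) = g w • z - mulRight w (diffRight g z) :=
  congr_tmul (diffRight g ∘ₗ mulRight w) (g w • LinearMap.id - mulRight w ∘ₗ diffRight g)
    (fun u x => by simp [contr_wedge, sgn_sgn, TensorProduct.tmul_sub]) z

theorem mulRight_mulLeft (v : M) (w : N) (z : Double A M N) :
    mulRight w (mulLeft v z) = -mulLeft v (mulRight w z) :=
  congr_tmul (mulRight w ∘ₗ mulLeft v) (-(mulLeft v ∘ₗ mulRight w))
    (fun u x => by simp [sgn_wedge, TensorProduct.neg_tmul]) z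

theorem mulRight_mulRight_comm (w w' : N) (z : Double A M N) :
    mulRight w (mulRight w' z) = -mulRight w' (mulRight w z) := by
  refine congr_tmul (mulRight w ∘ₗ mulRight w') (-(mulRight w' ∘ₗ mulRight w)) (fun u x => ?_) z
  have h := eq_neg_of_add_eq_zero_left (ExteriorAlgebra.ι_add_mul_swap (R := A) w w')
  simp only [LinearMap.comp_apply, mulRight_tmul, sgn_sgn, LinearMap.neg_apply, wedge_apply,
    ← mul_assoc, h, neg_mul, TensorProduct.tmul_neg]

theorem mulLeft_mulLeft (v : M) (z : Double A M N) : mulLeft v (mulLeft v z) = 0 :=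
  congr_tmul (mulLeft v ∘ₗ mulLeft v) 0 (fun u x => by simp [wedge_wedge]) z

theorem mulRight_mulRight (w : N) (z : Double A M N) : mulRight w (mulRight w z) = 0 :=
  congr_tmul (mulRight w ∘ₗ mulRight w) 0 (fun u x => by simp [wedge_wedge]) z

theorem evAug_mulLeft (v : M) (z : Double A M N) : evAug (mulLeft v z) = 0 :=
  congr_tmul (evAug ∘ₗ mulLeft v) 0 (fun u x => by simp [aug_wedge]) z

theorem evAug_mulRight (w : N) (z : Double A M N) : evAug (mulRight w z) = wedge w (evAug z) :=
  congr_tmul (evAug ∘ₗ mulRight w) (wedge w ∘ₗ evAug) (fun u x => by simp [aug_sgn]) z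

theorem ev_diffRight (t : ExteriorAlgebra A M →ₗ[A] A) (g : Module.Dual A N) (z : Double A M N) :
    ev t (diffRight g z) = contr g (ev (t ∘ₗ sgn) z) :=
  congr_tmul (ev t ∘ₗ diffRight g) (contr g ∘ₗ ev (t ∘ₗ sgn)) (fun u x => by simp) z

theorem evAug_diffRight (g : Module.Dual A N) (z : Double A M N) :
    evAug (diffRight g z) = contr g (evAug z) :=
  congr_tmul (evAug ∘ₗ diffRight g) (contr g ∘ₗ evAug) (fun u x => by simp [aug_sgn]) z

/-! ### The change of coordinates -/

/-- The vector `v + φ v` of `M × N` acting on the double complex by exterior multiplication. -/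
def act (φ : M →ₗ[A] N) : M →ₗ[A] Module.End A (Double A M N) where
  toFun v := mulLeft v + mulRight (φ v)
  map_add' v w := LinearMap.ext fun z => congr_tmul
    (mulLeft (v + w) + mulRight (φ (v + w)))
    (mulLeft v + mulRight (φ v) + (mulLeft w + mulRight (φ w)))
    (fun u x => by
      simp only [LinearMap.add_apply, mulLeft_tmul, mulRight_tmul, wedge_add, map_add,
        TensorProduct.add_tmul, TensorProduct.tmul_add]
      abel) z
  map_smul' c v := LinearMap.ext fun z => congr_tmul
    (mulLeft (c • v) + mulRight (φ (c • v))) (c • (mulLeft v + mulRight (φ v)))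
    (fun u x => by
      simp [wedge_smul, TensorProduct.smul_tmul']) z

theorem act_apply (φ : M →ₗ[A] N) (v : M) (z : Double A M N) :
    act φ v z = mulLeft v z + mulRight (φ v) z := rfl

theorem act_mul_act (φ : M →ₗ[A] N) (v : M) : act φ v * act φ v = 0 := by
  refine LinearMap.ext fun z => ?_
  simp [Module.End.mul_apply, act_apply, mulLeft_mulLeft, mulRight_mulRight, mulRight_mulLeft]

/-- The endomorphism of the double complex induced by the shear `(v, w) ↦ (v, w + φ v)` of
`M × N`, under the identification of `Λ(M × N)` with `ΛM ⊗ ΛN`. It is built from the action of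
`ΛM` on `ΛM ⊗ ΛN` in which `v` acts as multiplication by `v + φ v`. -/
def shear (φ : M →ₗ[A] N) : Double A M N →ₗ[A] Double A M N :=
  TensorProduct.lift
    (LinearMap.mk₂ A (fun u x => ExteriorAlgebra.lift A ⟨act φ, act_mul_act φ⟩ u (1 ⊗ₜ x))
      (fun u u' x => by simp) (fun c u x => by simp)
      (fun u x x' => by simp [TensorProduct.tmul_add]) (fun c u x => by simp))

theorem shear_tmul (φ : M →ₗ[A] N) (u : ExteriorAlgebra A M) (x : ExteriorAlgebra A N) :
    shear φ (u ⊗ₜ x) = ExteriorAlgebra.lift A ⟨act φ, act_mul_act φ⟩ u (1 ⊗ₜ x) := rfl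

theorem shear_one_tmul (φ : M →ₗ[A] N) (x : ExteriorAlgebra A N) :
    shear φ (1 ⊗ₜ x) = 1 ⊗ₜ x := by
  rw [shear_tmul, map_one, Module.End.one_apply]

theorem shear_mulLeft (φ : M →ₗ[A] N) (v : M) (z : Double A M N) :
    shear φ (mulLeft v z) = act φ v (shear φ z) :=
  congr_tmul (shear φ ∘ₗ mulLeft v) (act φ v ∘ₗ shear φ) (fun u x => by
    simp only [LinearMap.comp_apply, mulLeft_tmul, shear_tmul, wedge_apply]
    rw [map_mul, ExteriorAlgebra.lift_ι_apply, Module.End.mul_apply]) z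

theorem shear_mulRight (φ : M →ₗ[A] N) (w : N) (z : Double A M N) :
    shear φ (mulRight w z) = mulRight w (shear φ z) := by
  induction z using double_induction with
  | one x => simp [sgn_one, shear_one_tmul]
  | smul c z h => simp [h]
  | add y z hy hz => simp [hy, hz]
  | mul v z h =>
    rw [mulRight_mulLeft, map_neg, shear_mulLeft, shear_mulLeft, h, act_apply, act_apply, map_add,
      mulRight_mulLeft, mulRight_mulRight_comm w]
    abel

theorem shear_shear (ψ φ : M →ₗ[A] N) (z : Double A M N) :
    shear ψ (shear φ z) = shear (ψ + φ) z := by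
  induction z using double_induction with
  | one x => simp [shear_one_tmul]
  | smul c z h => simp [h]
  | add y z hy hz => simp [hy, hz]
  | mul v z h =>
    have hadd (y : Double A M N) :
        mulRight ((ψ + φ) v) y = mulRight (ψ v) y + mulRight (φ v) y :=
      congr_tmul (mulRight ((ψ + φ) v)) (mulRight (ψ v) + mulRight (φ v))
        (fun u x => by simp [wedge_add, TensorProduct.tmul_add]) y
    rw [shear_mulLeft, shear_mulLeft, act_apply, act_apply, map_add, shear_mulLeft,
      shear_mulRight, h, act_apply, hadd, add_assoc]

theorem shear_zero (z : Double A M N) : shear 0 z = z := by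
  induction z using double_induction with
  | one x => simp [shear_one_tmul]
  | smul c z h => simp [h]
  | add y z hy hz => simp [hy, hz]
  | mul v z h =>
    have h0 : mulRight ((0 : M →ₗ[A] N) v) z = 0 :=
      congr_tmul (mulRight ((0 : M →ₗ[A] N) v)) 0 (fun u x => by simp [wedge_apply]) z
    rw [shear_mulLeft, h, act_apply, h0, add_zero]

theorem shear_shear_neg (φ : M →ₗ[A] N) (z : Double A M N) : shear φ (shear (-φ) z) = z := by
  rw [shear_shear, add_neg_cancel, shear_zero]

theorem shear_neg_shear (φ : M →ₗ[A] N) (z : Double A M N) : shear (-φ) (shear φ z) = z := by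
  rw [shear_shear, neg_add_cancel, shear_zero]

theorem shear_injective (φ : M →ₗ[A] N) : Function.Injective (shear φ) :=
  Function.LeftInverse.injective (shear_neg_shear φ)

theorem diff_act {f : Module.Dual A M} {g : Module.Dual A N} {φ : M →ₗ[A] N}
    (h : ∀ v, f v = g (φ v)) (v : M) (z : Double A M N) :
    diff f g (act φ v z) = -act φ v (diff f g z) := by
  simp only [diff_apply, act_apply, map_add, map_sub, diffLeft_mulLeft, diffRight_mulLeft,
    diffLeft_mulRight, diffRight_mulRight, h v]
  abel

/-- If `f = g ∘ φ`, then the shear turns the differential of the double complex into the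
differential on the second factor alone. -/
theorem diff_shear {f : Module.Dual A M} {g : Module.Dual A N} {φ : M →ₗ[A] N}
    (h : ∀ v, f v = g (φ v)) (z : Double A M N) :
    diff f g (shear φ z) = -shear φ (diffRight g z) := by
  induction z using double_induction with
  | one x => simp [shear_one_tmul, diff_apply, contr_one, sgn_one]
  | smul c z h => simp [h]
  | add y z hy hz => simp [hy, hz, add_comm]
  | mul v z hz =>
    rw [shear_mulLeft, diff_act h, hz, diffRight_mulLeft, map_neg, map_neg, shear_mulLeft]

theorem evAug_shear (φ : M →ₗ[A] N) (u : ExteriorAlgebra A M) (x : ExteriorAlgebra A N) :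
    evAug (shear φ (u ⊗ₜ x)) = ExteriorAlgebra.map φ u * x := by
  induction u using wedge_induction with
  | one => simp [shear_one_tmul]
  | smul c u h => rw [← TensorProduct.smul_tmul', map_smul, map_smul, h, map_smul, smul_mul_assoc]
  | add u u' h h' => rw [TensorProduct.add_tmul, map_add, map_add, h, h', map_add, add_mul]
  | wedge v u h =>
    rw [← mulLeft_tmul, shear_mulLeft, act_apply, map_add, evAug_mulLeft, evAug_mulRight, h,
      zero_add, wedge_apply, wedge_apply, map_mul, ExteriorAlgebra.map_apply_ι, mul_assoc]

/-! ### Comparison with the Koszul complex modulo the first sequence -/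

theorem smul_top_map_mem {P Q : Type*} [AddCommGroup P] [Module A P] [AddCommGroup Q] [Module A Q]
    {I : Ideal A} (T : P →ₗ[A] Q) {x : P} (hx : x ∈ (I • ⊤ : Submodule A P)) :
    T x ∈ (I • ⊤ : Submodule A Q) := by
  have h := Submodule.mem_map_of_mem (f := T) hx
  rw [Submodule.map_smul''] at h
  exact Submodule.smul_mono le_rfl le_top h

/-- A linear form `f` is acyclic if every cycle of positive degree (that is, of augmentation zero)
of its Koszul complex is a boundary. Since `contr f` is homogeneous, there is no need to refer to
the grading. -/
def Acyclic (f : Module.Dual A M) : Prop :=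
  ∀ x : ExteriorAlgebra A M, contr f x = 0 → aug x = 0 → ∃ y, contr f y = x

theorem Acyclic.exact {f : Module.Dual A M} (hf : Acyclic f) :
    Function.Exact ((contr f).coprod (Algebra.linearMap A (ExteriorAlgebra A M))) (contr f) := by
  intro x
  constructor
  · intro hx
    obtain ⟨y, hy⟩ := hf (x - algebraMap A _ (aug x)) (by rw [map_sub, hx, contr_algebraMap,
      sub_zero]) (by rw [map_sub, aug_algebraMap, sub_self])
    exact ⟨(y, aug x), by simp [hy]⟩
  · rintro ⟨y, rfl⟩
    simp [contr_contr, contr_algebraMap]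

theorem evAug_diffLeft_mem (f : Module.Dual A M) (z : Double A M N) :
    evAug (diffLeft f z) ∈ (LinearMap.range f • ⊤ : Submodule A (ExteriorAlgebra A N)) := by
  induction z using TensorProduct.induction_on with
  | zero => simp
  | add y z hy hz => rw [map_add, map_add]; exact Submodule.add_mem _ hy hz
  | tmul u x =>
    rw [diffLeft_tmul, evAug_tmul]
    refine Submodule.smul_mem_smul ?_ trivial
    have h := smul_top_map_mem aug.toLinearMap
      (contr_mem_smul_top f (LinearMap.range f) (fun v => ⟨v, rfl⟩) u)
    rwa [smul_eq_mul, Ideal.mul_top] at h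

theorem one_tmul_mem_range_diffLeft (f : Module.Dual A M) {y : ExteriorAlgebra A N}
    (hy : y ∈ (LinearMap.range f • ⊤ : Submodule A (ExteriorAlgebra A N))) :
    ∃ w : Double A M N, diffLeft f w = 1 ⊗ₜ y := by
  induction hy using Submodule.smul_induction_on' with
  | smul c hc x _ =>
    obtain ⟨v, rfl⟩ := hc
    refine ⟨ExteriorAlgebra.ι A v ⊗ₜ x, ?_⟩
    have h : contr f (ExteriorAlgebra.ι A v) = f v • 1 := by
      simpa [wedge_apply, contr_one] using contr_wedge f v 1
    rw [diffLeft_tmul, h, TensorProduct.smul_tmul]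
  | add x _ y _ hx hy =>
    obtain ⟨w, hw⟩ := hx
    obtain ⟨w', hw'⟩ := hy
    exact ⟨w + w', by rw [map_add, hw, hw', TensorProduct.tmul_add]⟩

/-- A cycle of `K(f) ⊗ ΛN` whose augmentation vanishes modulo the values of `f` is a boundary,
since `ΛN` is flat. -/
theorem exists_diffLeft_eq [Module.Flat A (ExteriorAlgebra A N)] {f : Module.Dual A M}
    (hf : Acyclic f) {z : Double A M N} (hz : diffLeft f z = 0)
    (hz' : evAug z ∈ (LinearMap.range f • ⊤ : Submodule A (ExteriorAlgebra A N))) :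
    ∃ w, evAug w = 0 ∧ diffLeft f w = z := by
  obtain ⟨t, ht⟩ := (Module.Flat.rTensor_exact (ExteriorAlgebra A N) hf.exact z).1 hz
  have key : ∃ (w : Double A M N) (y : ExteriorAlgebra A N), z = diffLeft f w + 1 ⊗ₜ y := by
    rw [← ht]
    clear ht
    induction t using TensorProduct.induction_on with
    | zero => exact ⟨0, 0, by simp⟩
    | add s t hs ht =>
      obtain ⟨w, y, h⟩ := hs
      obtain ⟨w', y', h'⟩ := ht
      exact ⟨w + w', y + y', by rw [map_add, h, h', map_add, TensorProduct.tmul_add]; abel⟩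
    | tmul p x =>
      refine ⟨p.1 ⊗ₜ x, p.2 • x, ?_⟩
      simp [TensorProduct.add_tmul, Algebra.algebraMap_eq_smul_one, TensorProduct.smul_tmul]
  obtain ⟨w, y, rfl⟩ := key
  rw [map_add, evAug_tmul, aug_one, one_smul] at hz'
  obtain ⟨w', hw'⟩ := one_tmul_mem_range_diffLeft f
    ((Submodule.add_mem_iff_right _ (evAug_diffLeft_mem f w)).1 hz')
  refine ⟨w + w' - 1 ⊗ₜ evAug (w + w'), ?_, ?_⟩
  · rw [map_sub, evAug_tmul, aug_one, one_smul, sub_self]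
  · rw [map_sub, diffLeft_tmul, contr_one, TensorProduct.zero_tmul, sub_zero, map_add, hw']

/-- The truncation of the second factor to degrees `< k`. -/
def truncRight (k : ℕ) : Double A M N →ₗ[A] Double A M N :=
  (trunc k).lTensor _

theorem truncRight_tmul (k : ℕ) (u : ExteriorAlgebra A M) (x : ExteriorAlgebra A N) :
    truncRight k (u ⊗ₜ x : Double A M N) = u ⊗ₜ trunc k x := rfl

theorem truncRight_truncRight {j k : ℕ} (h : j ≤ k) (z : Double A M N) :
    truncRight k (truncRight j z) = truncRight j z :=
  congr_tmul (truncRight k ∘ₗ truncRight j) (truncRight j) (fun u x => by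
    have := LinearMap.congr_fun (trunc_comp_trunc (A := A) h) x
    simp only [LinearMap.comp_apply] at this
    simp [truncRight_tmul, this]) z

theorem diffRight_truncRight (g : Module.Dual A N) (k : ℕ) (z : Double A M N) :
    diffRight g (truncRight (k + 1) z) = truncRight k (diffRight g z) :=
  congr_tmul (diffRight g ∘ₗ truncRight (k + 1)) (truncRight k ∘ₗ diffRight g) (fun u x => by
    have := LinearMap.congr_fun (contr_comp_trunc g k) x
    simp only [LinearMap.comp_apply] at this
    simp [truncRight_tmul, this]) z

theorem diffLeft_truncRight (f : Module.Dual A M) (k : ℕ) (z : Double A M N) :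
    diffLeft f (truncRight k z) = truncRight k (diffLeft f z) :=
  congr_tmul (diffLeft f ∘ₗ truncRight k) (truncRight k ∘ₗ diffLeft f)
    (fun u x => by simp [truncRight_tmul]) z

theorem evAug_truncRight (k : ℕ) (z : Double A M N) :
    evAug (truncRight k z) = trunc k (evAug z) :=
  congr_tmul (evAug ∘ₗ truncRight k) (trunc k ∘ₗ evAug)
    (fun u x => by simp [truncRight_tmul]) z

theorem exists_truncRight_eq (z : Double A M N) : ∃ k, ∀ m, k ≤ m → truncRight m z = z := by
  induction z using TensorProduct.induction_on with
  | zero => exact ⟨0, by simp⟩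
  | add y z hy hz =>
    obtain ⟨k, hk⟩ := hy
    obtain ⟨l, hl⟩ := hz
    exact ⟨max k l, fun m hm => by
      rw [map_add, hk m (le_trans (le_max_left _ _) hm), hl m (le_trans (le_max_right _ _) hm)]⟩
  | tmul u x =>
    obtain ⟨k, hk⟩ := exists_trunc_eq x
    exact ⟨k, fun m hm => by rw [truncRight_tmul, hk m hm]⟩

/-- The augmentation from the double complex to the Koszul complex of `g` modulo the values of `f`
is injective on homology: a cycle whose augmentation vanishes modulo the values of `f` is a
boundary. The boundary is found by descending induction on the degree in the second factor. -/
theorem exists_diff_eq [Module.Flat A (ExteriorAlgebra A N)] {f : Module.Dual A M}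
    (hf : Acyclic f) (g : Module.Dual A N) {z : Double A M N} (hz : diff f g z = 0)
    (hz' : evAug z ∈ (LinearMap.range f • ⊤ : Submodule A (ExteriorAlgebra A N))) :
    ∃ w, evAug w = 0 ∧ diff f g w = z := by
  obtain ⟨k, hk⟩ := exists_truncRight_eq z
  replace hk := hk k le_rfl
  induction k generalizing z with
  | zero =>
    refine ⟨0, map_zero _, ?_⟩
    rw [map_zero, ← hk, truncRight, trunc_zero, LinearMap.lTensor_zero, LinearMap.zero_apply]
  | succ k ih =>
    have hFS : diffLeft f z = diffRight g z := sub_eq_zero.1 hz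
    -- The component of `z` of degree `k` in the second factor is a cycle for `diffLeft f`.
    obtain ⟨w, hw, hFw⟩ := exists_diffLeft_eq hf (z := z - truncRight k z)
      (by rw [map_sub, diffLeft_truncRight, hFS, ← diffRight_truncRight, hk, sub_self])
      (by rw [map_sub, evAug_truncRight]
          exact Submodule.sub_mem _ hz' (smul_top_map_mem _ hz'))
    let w₁ := truncRight (k + 1) w
    have hw₁ : evAug w₁ = 0 := by rw [evAug_truncRight, hw, map_zero]
    have hF : diffLeft f w₁ = z - truncRight k z := by
      rw [diffLeft_truncRight, hFw, map_sub, hk, truncRight_truncRight (Nat.le_succ k)]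
    have hsub : z - diff f g w₁ = truncRight k z + diffRight g w₁ := by
      rw [diff_apply, hF]; abel
    obtain ⟨w₂, hw₂, hD⟩ := ih (z := z - diff f g w₁)
      (by rw [map_sub, hz, diff_diff, sub_zero])
      (by rw [hsub, map_add, evAug_diffRight, hw₁, map_zero, add_zero, evAug_truncRight]
          exact smul_top_map_mem _ hz')
      (by rw [hsub, map_add, truncRight_truncRight le_rfl, ← diffRight_truncRight,
            truncRight_truncRight le_rfl])
    exact ⟨w₁ + w₂, by rw [map_add, hw₁, hw₂, add_zero], by rw [map_add, hD]; abel⟩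

/-- The augmentation from the double complex to the Koszul complex of `g` modulo the values of `f`
is surjective on homology. -/
theorem exists_cycle [Module.Flat A (ExteriorAlgebra A N)] {f : Module.Dual A M}
    (hf : Acyclic f) (g : Module.Dual A N) {y : ExteriorAlgebra A N}
    (hy : contr g y ∈ (LinearMap.range f • ⊤ : Submodule A (ExteriorAlgebra A N))) :
    ∃ z : Double A M N, diff f g z = 0 ∧ evAug z = y := by
  obtain ⟨w, hw, hD⟩ := exists_diff_eq hf g (z := diff f g (1 ⊗ₜ y)) (diff_diff f g _) (by
    rw [diff_apply, map_sub, evAug_diffRight, evAug_tmul, aug_one, one_smul]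
    exact Submodule.sub_mem _ (evAug_diffLeft_mem f _) hy)
  exact ⟨1 ⊗ₜ y - w, by rw [map_sub, hD, sub_self], by
    rw [map_sub, hw, sub_zero, evAug_tmul, aug_one, one_smul]⟩

end Double

/-! ### Koszul homology and acyclicity -/

section Homology

open CategoryTheory

universe u

variable {A : Type u} [CommRing A] {n : ℕ}

theorem coe_d (a : Fin n → A) (i : ℕ) (x : ⋀[A]^(i + 1) (Fin n → A)) :
    (d a i x : ExteriorAlgebra A (Fin n → A)) = contr (form a) x := rfl

theorem subsingleton_homology_iff (a : Fin n → A) (i : ℕ) :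
    Subsingleton (homology a (i + 1)) ↔
      ∀ x, d a i x = 0 → ∃ y, d a (i + 1) y = x := by
  have h1 : Subsingleton (homology a (i + 1)) ↔ (complex a).ExactAt (i + 1) := by
    rw [HomologicalComplex.exactAt_iff_isZero_homology]
    exact ⟨fun h => @ModuleCat.isZero_of_subsingleton _ _ _ h,
      fun h => ModuleCat.subsingleton_of_isZero h⟩
  rw [h1, (complex a).exactAt_iff' (i + 2) (i + 1) i (by simp) (by simp),
    ShortComplex.moduleCat_exact_iff]
  have hf : (complex a).d (i + 2) (i + 1) = ModuleCat.ofHom (d a (i + 1)) :=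
    ChainComplex.of_d (fun i => ModuleCat.of A (⋀[A]^i (Fin n → A)))
      (fun i => ModuleCat.ofHom (d a i)) (i + 1)
  have hg : (complex a).d (i + 1) i = ModuleCat.ofHom (d a i) :=
    ChainComplex.of_d (fun i => ModuleCat.of A (⋀[A]^i (Fin n → A)))
      (fun i => ModuleCat.ofHom (d a i)) i
  change (∀ x, (complex a).d (i + 1) i x = 0 → ∃ y, (complex a).d (i + 2) (i + 1) y = x) ↔ _
  rw [hf, hg]
  rfl

theorem completelySequent_iff_acyclic (a : Fin n → A) :
    CompletelySequent a ↔ Acyclic (form a) := by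
  constructor
  · intro h x hx hx0
    have key (j : ℕ) : ∃ y, contr (form a) y = component j x := by
      cases j with
      | zero => exact ⟨0, by rw [component_zero, hx0, map_zero, map_zero]⟩
      | succ j =>
        obtain ⟨y, hy⟩ := (subsingleton_homology_iff a j).1 (h (j + 1) (by omega))
          ⟨component (j + 1) x, component_mem _ x⟩
          (Subtype.ext (by rw [coe_d, ← component_contr, hx, map_zero]; rfl))
        exact ⟨y, by rw [← coe_d, hy]⟩
    choose y hy using key
    obtain ⟨k, hk⟩ := exists_trunc_eq x
    refine ⟨∑ j ∈ Finset.range k, y j, ?_⟩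
    rw [map_sum]
    simp only [hy]
    rw [← LinearMap.sum_apply]
    exact hk k le_rfl
  · intro h i hi
    obtain ⟨i, rfl⟩ := Nat.exists_eq_add_of_le' hi
    rw [subsingleton_homology_iff]
    intro x hx
    obtain ⟨y, hy⟩ := h x (by rw [← coe_d, hx]; rfl) (aug_of_mem x.2)
    refine ⟨⟨component (i + 2) y, component_mem _ y⟩, Subtype.ext ?_⟩
    rw [coe_d, ← component_contr, hy, component_of_mem x.2, if_pos rfl]

end Homology

/-! ### The colon ideals -/

section Colon

variable {A : Type*} [CommRing A] {n : ℕ}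

instance : Module.Free A (ExteriorAlgebra A (Fin n → A)) :=
  Module.Free.of_basis (Pi.basisFun A (Fin n)).ExteriorAlgebra

theorem form_apply (a v : Fin n → A) : form a v = a ⬝ᵥ v := by
  simp [form, dotProduct, LinearMap.sum_apply]

theorem range_form (a : Fin n → A) : LinearMap.range (form a) = J a := by
  ext c
  rw [J, Ideal.mem_span_range_iff_exists_fun]
  simp [form_apply, dotProduct, mul_comm]

theorem aug_contr_mem_range (f : Module.Dual A (Fin n → A)) (x : ExteriorAlgebra A (Fin n → A)) :
    aug (contr f x) ∈ LinearMap.range f := by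
  have h := smul_top_map_mem aug.toLinearMap
    (contr_mem_smul_top f (LinearMap.range f) (fun v => ⟨v, rfl⟩) x)
  rwa [smul_eq_mul, Ideal.mul_top] at h

variable {f g : Module.Dual A (Fin n → A)} {φ : Matrix (Fin n) (Fin n) A}

/-- A cycle `x` of `K(g)` is a boundary as soon as `det φ • (e_1 ∧ ⋯ ∧ e_n ∧ x)` vanishes modulo
the values of `f`: then `shear φ` sends `e_1 ∧ ⋯ ∧ e_n ⊗ x` to a boundary of the double complex,
hence `e_1 ∧ ⋯ ∧ e_n ⊗ x` is a boundary for the differential on the second factor. -/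
theorem exists_contr_eq (hf : Acyclic f) (h : ∀ v, f v = g (φ.mulVecLin v))
    {x : ExteriorAlgebra A (Fin n → A)} (hx : contr g x = 0)
    (hx' : φ.det * aug x ∈ LinearMap.range f) : ∃ y, contr g y = x := by
  obtain ⟨w, -, hw⟩ := exists_diff_eq hf g (z := shear φ.mulVecLin (top ⊗ₜ x))
    (by rw [diff_shear h, diffRight_tmul, hx, TensorProduct.tmul_zero, map_zero, neg_zero])
    (by rw [evAug_shear, map_top, smul_mul_assoc, top_mul, smul_smul]
        exact Submodule.smul_mem_smul hx' trivial)
  have hR : -diffRight g (shear (-φ.mulVecLin) w) = top ⊗ₜ x := by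
    apply shear_injective φ.mulVecLin
    rw [← hw, map_neg, ← diff_shear h, shear_shear_neg]
  refine ⟨-ev (topCoeff ∘ₗ sgn) (shear (-φ.mulVecLin) w), ?_⟩
  rw [map_neg, ← ev_diffRight, ← map_neg, hR, ev_tmul, topCoeff_top, one_smul]

theorem Acyclic.of_comp (hf : Acyclic f) (h : ∀ v, f v = g (φ.mulVecLin v)) : Acyclic g :=
  fun x hx hx0 => exists_contr_eq hf h hx (by rw [hx0, mul_zero]; exact Submodule.zero_mem _)

theorem mem_range_of_det_mul_mem (hf : Acyclic f) (h : ∀ v, f v = g (φ.mulVecLin v)) {c : A}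
    (hc : φ.det * c ∈ LinearMap.range f) : c ∈ LinearMap.range g := by
  obtain ⟨y, hy⟩ := exists_contr_eq hf h (contr_algebraMap g c) (by rwa [aug_algebraMap])
  rw [← aug_algebraMap (A := A) (M := Fin n → A) c, ← hy]
  exact aug_contr_mem_range g y

/-- If `c` multiplies the values of `g` into those of `f`, then `c • (e_1 ∧ ⋯ ∧ e_n)` is a cycle
of `K(g)` modulo the values of `f`. It lifts to a cycle of the double complex, which in sheared
coordinates is, up to a boundary, of the form `u ⊗ 1`; comparing top coefficients shows that `c`
is a multiple of `det φ` modulo the values of `f`. -/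
theorem exists_sub_det_mul_mem (hf : Acyclic f) (h : ∀ v, f v = g (φ.mulVecLin v)) {c : A}
    (hc : ∀ v, c * g v ∈ LinearMap.range f) : ∃ t, c - φ.det * t ∈ LinearMap.range f := by
  obtain ⟨z, hz, hzc⟩ := exists_cycle hf g (y := c • top) (by
    have h1 : contr g (c • top) = contr (c • g) top := by
      rw [contr, contr, map_smul, map_smul, LinearMap.smul_apply]
    rw [h1]
    exact contr_mem_smul_top (c • g) _ hc _)
  have hS : diffRight g (shear (-φ.mulVecLin) z) = 0 := by
    apply shear_injective φ.mulVecLin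
    rw [map_zero, ← neg_eq_zero, ← diff_shear h, shear_shear_neg, hz]
  have hS' : (contr g).lTensor (ExteriorAlgebra A (Fin n → A))
      (shear (-φ.mulVecLin) z) = 0 := by
    have h1 := congr_tmul ((sgn (A := A) (M := Fin n → A)).rTensor _ ∘ₗ diffRight g)
      ((contr g).lTensor _) (fun u x => by simp [sgn_sgn]) (shear (-φ.mulVecLin) z)
    rw [← h1, LinearMap.comp_apply, hS, map_zero]
  obtain ⟨t, ht⟩ := (Module.Flat.lTensor_exact (ExteriorAlgebra A (Fin n → A))
    (hf.of_comp h).exact _).1 hS'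
  have key : ∃ (w : Double A (Fin n → A) (Fin n → A)) (u : ExteriorAlgebra A (Fin n → A)),
      shear (-φ.mulVecLin) z = diffRight g w + u ⊗ₜ 1 := by
    rw [← ht]
    clear ht
    induction t using TensorProduct.induction_on with
    | zero => exact ⟨0, 0, by simp⟩
    | add s t hs ht =>
      obtain ⟨w, u, h⟩ := hs
      obtain ⟨w', u', h'⟩ := ht
      exact ⟨w + w', u + u', by rw [map_add, h, h', map_add, TensorProduct.add_tmul]; abel⟩
    | tmul u p =>
      refine ⟨sgn u ⊗ₜ p.1, p.2 • u, ?_⟩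
      simp [TensorProduct.tmul_add, Algebra.algebraMap_eq_smul_one, sgn_sgn,
        TensorProduct.smul_tmul']
  obtain ⟨w, u, hw⟩ := key
  have hz2 : z = -diff f g (shear φ.mulVecLin w) + shear φ.mulVecLin (u ⊗ₜ 1) := by
    rw [diff_shear h, neg_neg, ← map_add, ← hw, shear_shear_neg]
  refine ⟨topCoeff u, ?_⟩
  have hc' : c = topCoeff (evAug z) := by rw [hzc, map_smul, topCoeff_top, smul_eq_mul, mul_one]
  rw [hc', hz2, map_add, map_add, evAug_shear, mul_one, topCoeff_map, add_sub_cancel_right,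
    map_neg, map_neg, diff_apply, map_sub, map_sub, evAug_diffRight, topCoeff_contr, sub_zero]
  have h2 := smul_top_map_mem topCoeff (evAug_diffLeft_mem f (shear φ.mulVecLin w))
  rw [smul_eq_mul, Ideal.mul_top] at h2
  exact Submodule.neg_mem _ h2

/-- By Cramer's rule `det φ` multiplies the entries of `a` into the ideal of the entries of
`a · φ`. -/
theorem mul_det_mem {a : Fin n → A} {c : A} (hc : c ∈ J a) :
    c * φ.det ∈ J (Matrix.vecMul a φ) := by
  rw [← range_form] at hc ⊢
  obtain ⟨v, rfl⟩ := hc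
  refine ⟨φ.adjugate.mulVec v, ?_⟩
  rw [form_apply, form_apply, ← Matrix.dotProduct_mulVec, Matrix.mulVec_mulVec,
    Matrix.mul_adjugate, Matrix.smul_mulVec, Matrix.one_mulVec, dotProduct_smul, smul_eq_mul,
    mul_comm]

end Colon

end Koszul

end

theorem proposition1p2 {A : Type*} [CommRing A] {n : ℕ} (a b : Fin n → A)
    (hJ : Koszul.J b ≤ Koszul.J a) (hb : Koszul.CompletelySequent b)
    (φ : Matrix (Fin n) (Fin n) A) (hφ : b = Matrix.vecMul a φ) :
    Koszul.CompletelySequent a ∧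
    (Koszul.J b).colon (Koszul.J a : Set A) = Koszul.J b ⊔ Ideal.span {φ.det} ∧
    (Koszul.J b).colon ((Koszul.J b ⊔ Ideal.span {φ.det} : Ideal A) : Set A) = Koszul.J a ∧
    (Koszul.J a ≠ ⊤ → φ.det ∉ Koszul.J b) := by
  have hf : Koszul.Acyclic (Koszul.form b) := (Koszul.completelySequent_iff_acyclic b).1 hb
  have h : ∀ v, Koszul.form b v = Koszul.form a (φ.mulVecLin v) := fun v => by
    rw [Koszul.form_apply, Koszul.form_apply, hφ, Matrix.mulVecLin_apply,
      Matrix.dotProduct_mulVec]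
  have hdet {c : A} (hc : c ∈ Koszul.J a) : c * φ.det ∈ Koszul.J b := by
    rw [hφ]; exact Koszul.mul_det_mem hc
  have hdet' {c : A} (hc : φ.det * c ∈ Koszul.J b) : c ∈ Koszul.J a := by
    rw [← Koszul.range_form] at hc ⊢
    exact Koszul.mem_range_of_det_mul_mem hf h hc
  refine ⟨(Koszul.completelySequent_iff_acyclic a).2 (hf.of_comp h), ?_, ?_, ?_⟩
  · apply le_antisymm
    · intro c hc
      rw [Submodule.mem_colon] at hc
      obtain ⟨t, ht⟩ := Koszul.exists_sub_det_mul_mem hf h (c := c) (fun v => by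
        rw [Koszul.range_form]
        exact hc _ (by rw [← Koszul.range_form]; exact ⟨v, rfl⟩))
      rw [Koszul.range_form] at ht
      rw [← sub_add_cancel c (φ.det * t)]
      exact Submodule.add_mem_sup ht (Ideal.mul_mem_right _ _ (Ideal.mem_span_singleton_self _))
    · refine sup_le Ideal.le_colon ((Ideal.span_singleton_le_iff_mem _).2 ?_)
      rw [Submodule.mem_colon]
      intro c hc
      rw [smul_eq_mul, mul_comm]
      exact hdet hc
  · apply le_antisymm
    · intro c hc
      rw [Submodule.mem_colon] at hc
      refine hdet' ?_
      rw [mul_comm]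
      exact hc _ (Ideal.mem_sup_right (Ideal.mem_span_singleton_self _))
    · intro c hc
      rw [Submodule.mem_colon]
      intro s hs
      obtain ⟨y, hy, t, ht, rfl⟩ := Submodule.mem_sup.1 hs
      obtain ⟨r, rfl⟩ := Ideal.mem_span_singleton'.1 ht
      rw [smul_add, smul_eq_mul, smul_eq_mul, mul_left_comm]
      exact Ideal.add_mem _ (Ideal.mul_mem_left _ _ hy) (Ideal.mul_mem_left _ _ (hdet hc))
  · intro ha hd
    exact ha ((Ideal.eq_top_iff_one _).2 (hdet' (by rwa [mul_one])))
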